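/- **Definitions.** A *$\sigma$-semiring* is a partially ordered set $\mathcal B$ with least element $0$ and greatest lower bounds $ab=a\wedge b$ of all pairs, together with a family of *summable* subsets $A\subseteq\mathcal B\setminus\{0\}$, each of them at most countable and consisting of pairwise disjoint elements ($ab=0$ for $a\ne b$ in $A$), each having a least upper bound $\sum A:=\bigvee A$, such that 1. $\emptyset$ and all $\{a\}$, $a\neq 0$, are summable; if $A$ is summable and each $a\in A$ is the sum $a=\sum D_a$ of a summable set $D_a$, then $\bigcup_{a\in A}D_a$ is summable; 2. if $A$ is summable and $a\in\mathcal B$, then $\{ax:x\in A\}\setminus\{0\}$ is summable and $a\sum_{x\in A}x=\sum_{x\in A}ax$; 3. for all $a,b\in\mathcal B$ there are a finite summable set $C$ and summable subsets $A_1,A_2\subseteq C$ with $a=\sum A_1$, $b=\sum A_2$, such that $A_1\cap A_2$ is summable and $ab=\sum (A_1\cap A_2)$; 4. every nonempty countable family in $\mathcal B$ has a greatest lower bound. A $\sigma$-isomorphism of $\sigma$-semirings is an order isomorphism under which the summable sets correspond to each other (hence it preserves $0$, products, sums and countable greatest lower bounds in both directions). A $\sigma$-semiring inside a Boolean ring $Q$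 is a subset of $Q$, with a family of summable subsets, which is a $\sigma$-semiring whose order, zero, products, sums and countable greatest lower bounds are those of $Q$. Let $X_0$ be the set of maximal (proper, nonempty) filters of $\mathcal B$ with the topology whose base consists of the sets $h_0(b)=\{x\in X_0: b\in x\}$, $b\in\mathcal B$. Let $\mathcal A_0$ be the ring of all open compact subsets of $X_0$, let $\mathcal A_\sigma=\mathcal A_0\vee\Delta_\sigma$ be the $\sigma$-ring of subsets of $X_0$ generated by $\mathcal A_0$ and the compact sets of the first category, and let $\Delta_\sigma$ be the $\sigma$-ideal of $\mathcal A_\sigma$ generated by the compact sets of the first category, i.e. the set of those members of $\mathcal A_\sigma$ that are covered by countably many compact sets of the first category. In the factor algebra $\mathcal A_\sigma/\Delta_\sigma$ one has $[A]\le[A']$ iff $A\setminus A'\in\Delta_\sigma$. **Theorem.** Let $\mathcal B$ be a $\sigma$-semiring. Then $X_0$ is a locally compact Hausdorff space, $h_0(b)\in\mathcal A_\sigma$ for all $b\in\mathcal B$, and $b\mapsto[h_0(b)]$ is a $\sigma$-isomorphism of $\mathcal B$ onto some $\sigma$-semiring $\mathcal B_\sigma\subseteq\mathcal A_\sigma/\Delta_\sigma$.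 -/

import Mathlib

open Set

universe u

/-! ### Boolean σ-semirings -/

/-- A (Boolean) `σ`-semiring: a semilogic in which the conjunction `a ⊓ b` is everywhere defined,
with zero `⊥`, whose logical sums `∑ A` are defined for certain ("summable") at most countable
sets `A` of nonzero, pairwise disjoint elements, are equal to the least upper bounds, and are
distributive under `⊓`; moreover all countable greatest lower bounds exist. -/
class SigmaSemiring (B : Type u) extends SemilatticeInf B, OrderBot B where
  /-- the sets of elements whose logical sum is defined -/
  IsSummable : Set B → Prop
  /-- zero is not listed among the summands -/
  bot_notMem : ∀ {A : Set B}, IsSummable A → ⊥ ∉ A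
  /-- the summands are pairwise orthogonal -/
  disjoint : ∀ {A : Set B}, IsSummable A → ∀ a ∈ A, ∀ b ∈ A, a ≠ b → a ⊓ b = ⊥
  /-- the rank is (at most) `σ` -/
  countable : ∀ {A : Set B}, IsSummable A → A.Countable
  /-- the logical sum of a summable set is its least upper bound -/
  exists_isLUB : ∀ {A : Set B}, IsSummable A → ∃ s, IsLUB A s
  /-- the empty sum (it is equal to `⊥`) -/
  isSummable_empty : IsSummable ∅
  /-- one-element sums -/
  isSummable_singleton : ∀ {a : B}, a ≠ ⊥ → IsSummable {a}
  /-- associativity: summable decompositions `D a` of the members `a` of a summable set can be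
  put together -/
  isSummable_biUnion : ∀ {A : Set B} (D : B → Set B), IsSummable A →
    (∀ a ∈ A, IsSummable (D a) ∧ IsLUB (D a) a) → IsSummable (⋃ a ∈ A, D a)
  /-- the nonzero products `a ⊓ x` of the members `x` of a summable set are summable -/
  isSummable_inf : ∀ (a : B) {A : Set B}, IsSummable A →
    IsSummable ((fun x => a ⊓ x) '' A \ {⊥})
  /-- distributivity: `a ⊓ ∑ x = ∑ (a ⊓ x)` -/
  isLUB_inf : ∀ (a : B) {A : Set B} {s : B}, IsSummable A → IsLUB A s →
    IsLUB ((fun x => a ⊓ x) '' A) (a ⊓ s)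
  /-- any two elements have finite decompositions `A₁`, `A₂`, contained in a finite summable
  set `C`, such that `A₁ ∩ A₂` is a decomposition of their product -/
  exists_decomposition : ∀ a b : B, ∃ A₁ A₂ C : Set B, C.Finite ∧ IsSummable C ∧
    A₁ ⊆ C ∧ A₂ ⊆ C ∧ (IsSummable A₁ ∧ IsLUB A₁ a) ∧ (IsSummable A₂ ∧ IsLUB A₂ b) ∧
    (IsSummable (A₁ ∩ A₂) ∧ IsLUB (A₁ ∩ A₂) (a ⊓ b))
  /-- countable greatest lower bounds exist -/
  exists_isGLB : ∀ f : ℕ → B, ∃ b, IsGLB (range f) b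

/-- A `σ`-isomorphism of `σ`-semirings: a bijection preserving, in both directions, the order and
summability, and hence zero, products, logical sums and countable greatest lower bounds. -/
structure SigmaSemiring.Iso (B : Type*) (C : Type*) [SigmaSemiring B] [SigmaSemiring C] where
  toOrderIso : B ≃o C
  isSummable_iff : ∀ A : Set B,
    SigmaSemiring.IsSummable (toOrderIso '' A) ↔ SigmaSemiring.IsSummable A

/-! ### σ-semirings inside a Boolean ring -/

/-- A `σ`-semiring `S ⊆ Q` inside a Boolean ring `Q` (not necessarily with unit): zero, products,
logical sums and countable greatest lower bounds in `S` are those of `Q`. -/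
structure SigmaSubsemiring (Q : Type u) [GeneralizedBooleanAlgebra Q] where
  carrier : Set Q
  IsSummable : Set Q → Prop
  bot_mem : ⊥ ∈ carrier
  inf_mem : ∀ {a b : Q}, a ∈ carrier → b ∈ carrier → a ⊓ b ∈ carrier
  subset_carrier : ∀ {A : Set Q}, IsSummable A → A ⊆ carrier
  bot_notMem : ∀ {A : Set Q}, IsSummable A → ⊥ ∉ A
  disjoint : ∀ {A : Set Q}, IsSummable A → ∀ a ∈ A, ∀ b ∈ A, a ≠ b → a ⊓ b = ⊥
  countable : ∀ {A : Set Q}, IsSummable A → A.Countable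
  exists_isLUB : ∀ {A : Set Q}, IsSummable A → ∃ s ∈ carrier, IsLUB A s
  isSummable_empty : IsSummable ∅
  isSummable_singleton : ∀ {a : Q}, a ∈ carrier → a ≠ ⊥ → IsSummable {a}
  isSummable_biUnion : ∀ {A : Set Q} (D : Q → Set Q), IsSummable A →
    (∀ a ∈ A, IsSummable (D a) ∧ IsLUB (D a) a) → IsSummable (⋃ a ∈ A, D a)
  isSummable_inf : ∀ {a : Q} {A : Set Q}, a ∈ carrier → IsSummable A →
    IsSummable ((fun x => a ⊓ x) '' A \ {⊥})
  exists_decomposition : ∀ {a b : Q}, a ∈ carrier → b ∈ carrier →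
    ∃ A₁ A₂ C : Set Q, C.Finite ∧ IsSummable C ∧
    A₁ ⊆ C ∧ A₂ ⊆ C ∧ (IsSummable A₁ ∧ IsLUB A₁ a) ∧ (IsSummable A₂ ∧ IsLUB A₂ b) ∧
    (IsSummable (A₁ ∩ A₂) ∧ IsLUB (A₁ ∩ A₂) (a ⊓ b))
  exists_isGLB : ∀ f : ℕ → Q, (∀ n, f n ∈ carrier) → ∃ b ∈ carrier, IsGLB (range f) b

namespace SigmaSubsemiring

variable {Q : Type u} [GeneralizedBooleanAlgebra Q]

instance : CoeSort (SigmaSubsemiring Q) (Type u) := ⟨fun S => S.carrier⟩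

theorem isLUB_inf_of_isLUB {A : Set Q} {s : Q} (a : Q) (h : IsLUB A s) :
    IsLUB ((fun x => a ⊓ x) '' A) (a ⊓ s) := by
  constructor
  · rintro _ ⟨x, hx, rfl⟩
    exact inf_le_inf_left a (h.1 hx)
  · intro v hv
    have h1 : s ≤ s \ (a \ v) := by
      refine h.2 fun x hx => ?_
      have h2 : a ⊓ x ≤ v := hv ⟨x, hx, rfl⟩
      refine le_sdiff.2 ⟨h.1 hx, ?_⟩
      rw [disjoint_iff, ← inf_sdiff_assoc, inf_comm, sdiff_eq_bot_iff]
      exact h2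
    have h3 : Disjoint s (a \ v) := (le_sdiff.1 h1).2
    rw [disjoint_iff, ← inf_sdiff_assoc, inf_comm, sdiff_eq_bot_iff] at h3
    exact h3

theorem isLUB_coe {S : Set Q} {A : Set S} {s : S} (h : IsLUB (Subtype.val '' A) s.1) :
    IsLUB A s :=
  ⟨fun x hx => h.1 ⟨x, hx, rfl⟩,
    fun v hv => h.2 (by rintro _ ⟨x, hx, rfl⟩; exact hv hx)⟩

theorem isLUB_val (S : SigmaSubsemiring Q) {A : Set S} {s : S}
    (hA : S.IsSummable (Subtype.val '' A)) (h : IsLUB A s) :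
    IsLUB (Subtype.val '' A) s.1 := by
  obtain ⟨t, ht, hl⟩ := S.exists_isLUB hA
  have h1 : s = ⟨t, ht⟩ := h.unique (isLUB_coe (s := ⟨t, ht⟩) hl)
  rw [h1]
  exact hl

/-- A `σ`-semiring inside a Boolean ring is a `σ`-semiring. -/
instance (S : SigmaSubsemiring Q) : SigmaSemiring S where
  inf a b := ⟨a.1 ⊓ b.1, S.inf_mem a.2 b.2⟩
  inf_le_left a b := inf_le_left (a := a.1)
  inf_le_right a b := inf_le_right (a := a.1)
  le_inf a b c h1 h2 := _root_.le_inf (show a.1 ≤ b.1 from h1) (show a.1 ≤ c.1 from h2)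
  bot := ⟨⊥, S.bot_mem⟩
  bot_le a := bot_le (a := a.1)
  IsSummable A := S.IsSummable (Subtype.val '' A)
  bot_notMem {A} h h0 := S.bot_notMem h ⟨_, h0, rfl⟩
  disjoint {A} h a ha b hb hab := Subtype.ext <|
    S.disjoint h a.1 ⟨a, ha, rfl⟩ b.1 ⟨b, hb, rfl⟩ fun h => hab (Subtype.ext h)
  countable {A} h := by
    have h1 := S.countable h
    exact countable_of_injective_of_countable_image Subtype.val_injective.injOn h1
  exists_isLUB {A} h := by
    obtain ⟨s, hs, hl⟩ := S.exists_isLUB h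
    exact ⟨⟨s, hs⟩, isLUB_coe hl⟩
  isSummable_empty := by simpa using S.isSummable_empty
  isSummable_singleton {a} ha := by
    rw [image_singleton]
    exact S.isSummable_singleton a.2 fun h => ha (Subtype.ext h)
  isSummable_biUnion {A} D hA hD := by
    classical
    have key := S.isSummable_biUnion
      (fun q => if h : q ∈ S.carrier then Subtype.val '' D ⟨q, h⟩ else ∅) hA ?_
    · convert key using 1
      ext q
      constructor
      · rintro ⟨y, hy, rfl⟩
        obtain ⟨a, ha, hya⟩ := mem_iUnion₂.1 hy
        refine mem_iUnion₂.2 ⟨a.1, ⟨a, ha, rfl⟩, ?_⟩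
        rw [dif_pos a.2]
        exact ⟨y, hya, rfl⟩
      · intro hq
        obtain ⟨_, ⟨a, ha, rfl⟩, hq⟩ := mem_iUnion₂.1 hq
        rw [dif_pos a.2] at hq
        obtain ⟨y, hy, rfl⟩ := hq
        exact ⟨y, mem_iUnion₂.2 ⟨a, ha, hy⟩, rfl⟩
    · rintro _ ⟨a, ha, rfl⟩
      have h1 : a.1 ∈ S.carrier := a.2
      simp only [h1, dite_true]
      exact ⟨(hD a ha).1, isLUB_val S (hD a ha).1 (hD a ha).2⟩
  isSummable_inf a {A} h := by
    convert S.isSummable_inf a.2 h using 1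
    ext q
    constructor
    · rintro ⟨_, ⟨⟨x, hx, rfl⟩, h1⟩, rfl⟩
      exact ⟨⟨x.1, ⟨x, hx, rfl⟩, rfl⟩, fun h2 => h1 (Subtype.ext h2)⟩
    · rintro ⟨⟨_, ⟨x, hx, rfl⟩, rfl⟩, h1⟩
      exact ⟨⟨a.1 ⊓ x.1, S.inf_mem a.2 x.2⟩,
        ⟨⟨x, hx, rfl⟩, fun h2 => h1 (congrArg Subtype.val h2)⟩, rfl⟩
  isLUB_inf a {A} s h hs := by
    refine isLUB_coe ?_
    have h1 := isLUB_inf_of_isLUB a.1 (isLUB_val S h hs)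
    rw [image_image] at h1 ⊢
    exact h1
  exists_decomposition a b := by
    obtain ⟨A₁, A₂, C, hC, hCs, h1, h2, hA, hB, hAB⟩ := S.exists_decomposition a.2 b.2
    have e : ∀ A : Set Q, S.IsSummable A →
        Subtype.val '' (Subtype.val ⁻¹' A : Set S.carrier) = A := fun A hA => by
      rw [Subtype.image_preimage_coe]
      exact inter_eq_right.2 (S.subset_carrier hA)
    refine ⟨Subtype.val ⁻¹' A₁, Subtype.val ⁻¹' A₂, Subtype.val ⁻¹' C,
      hC.preimage Subtype.val_injective.injOn, by rwa [e C hCs],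
      preimage_mono h1, preimage_mono h2, ⟨by rw [e A₁ hA.1]; exact hA.1, isLUB_coe ?_⟩,
      ⟨by rw [e A₂ hB.1]; exact hB.1, isLUB_coe ?_⟩,
      ⟨by rw [← preimage_inter, e _ hAB.1]; exact hAB.1, isLUB_coe ?_⟩⟩
    · rw [e A₁ hA.1]; exact hA.2
    · rw [e A₂ hB.1]; exact hB.2
    · rw [← preimage_inter, e _ hAB.1]; exact hAB.2
  exists_isGLB f := by
    obtain ⟨b, hb, h1, h2⟩ := S.exists_isGLB (fun n => (f n).1) fun n => (f n).2
    refine ⟨⟨b, hb⟩, ?_, ?_⟩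
    · rintro _ ⟨n, rfl⟩
      exact h1 ⟨n, rfl⟩
    · intro v hv
      refine h2 (a := v.1) ?_
      rintro _ ⟨n, rfl⟩
      exact hv ⟨n, rfl⟩

end SigmaSubsemiring

/-! ### Set σ-rings, σ-ideals and factor algebras -/

/-- A `σ`-ring of subsets of `X` (not necessarily containing `X`). -/
structure SigmaRing (X : Type u) where
  carrier : Set (Set X)
  empty_mem : ∅ ∈ carrier
  diff_mem : ∀ {s t : Set X}, s ∈ carrier → t ∈ carrier → s \ t ∈ carrier
  iUnion_mem : ∀ {f : ℕ → Set X}, (∀ n, f n ∈ carrier) → (⋃ n, f n) ∈ carrier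

namespace SigmaRing

variable {X : Type u}

theorem inter_mem (R : SigmaRing X) {s t : Set X} (hs : s ∈ R.carrier) (ht : t ∈ R.carrier) :
    s ∩ t ∈ R.carrier := by
  rw [← sdiff_sdiff_right_self]
  exact R.diff_mem hs (R.diff_mem hs ht)

theorem union_mem (R : SigmaRing X) {s t : Set X} (hs : s ∈ R.carrier) (ht : t ∈ R.carrier) :
    s ∪ t ∈ R.carrier := by
  rw [union_eq_iUnion]
  have h : (⋃ b : Bool, cond b s t) = ⋃ n : ℕ, if n = 0 then s else t := by
    ext x
    simp only [mem_iUnion, Bool.exists_bool]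
    constructor
    · rintro (h | h)
      · exact ⟨1, by simpa using h⟩
      · exact ⟨0, by simpa using h⟩
    · rintro ⟨n, h⟩
      by_cases hn : n = 0
      · right; simpa [hn] using h
      · left; simpa [hn] using h
  rw [h]
  refine R.iUnion_mem fun n => ?_
  split_ifs <;> assumption

/-- The smallest `σ`-ring of subsets of `X` containing the family `G`. -/
def generate (G : Set (Set X)) : SigmaRing X where
  carrier := {s | ∀ R : SigmaRing X, G ⊆ R.carrier → s ∈ R.carrier}
  empty_mem R _ := R.empty_mem
  diff_mem hs ht R h := R.diff_mem (hs R h) (ht R h)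
  iUnion_mem hf R h := R.iUnion_mem fun n => hf n R h

theorem subset_generate (G : Set (Set X)) : G ⊆ (generate G).carrier :=
  fun _ hs _ h => h hs

end SigmaRing

/-- A `σ`-ideal of a `σ`-ring of sets. -/
structure SigmaIdeal {X : Type u} (R : SigmaRing X) where
  carrier : Set (Set X)
  subset : carrier ⊆ R.carrier
  empty_mem : ∅ ∈ carrier
  inter_mem : ∀ {s t : Set X}, s ∈ R.carrier → t ∈ carrier → s ∩ t ∈ carrier
  iUnion_mem : ∀ {f : ℕ → Set X}, (∀ n, f n ∈ carrier) → (⋃ n, f n) ∈ carrier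

namespace SigmaIdeal

variable {X : Type u} {R : SigmaRing X} (D : SigmaIdeal R)

theorem mem_of_subset {s t : Set X} (hs : s ∈ R.carrier) (ht : t ∈ D.carrier) (h : s ⊆ t) :
    s ∈ D.carrier := by
  rw [← inter_eq_left.2 h]
  exact D.inter_mem hs ht

theorem union_mem {s t : Set X} (hs : s ∈ D.carrier) (ht : t ∈ D.carrier) :
    s ∪ t ∈ D.carrier := by
  refine D.mem_of_subset (R.union_mem (D.subset hs) (D.subset ht))
    (D.iUnion_mem (f := fun n : ℕ => if n = 0 then s else t) fun n => ?_) ?_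
  · show (if n = 0 then s else t) ∈ D.carrier
    split_ifs <;> assumption
  · rintro x (hx | hx)
    · exact mem_iUnion.2 ⟨0, by simpa using hx⟩
    · exact mem_iUnion.2 ⟨1, by simpa using hx⟩

theorem diff_trans {r s t : Set X} (hr : r ∈ R.carrier) (ht : t ∈ R.carrier)
    (h1 : r \ s ∈ D.carrier) (h2 : s \ t ∈ D.carrier) : r \ t ∈ D.carrier :=
  D.mem_of_subset (R.diff_mem hr ht) (D.union_mem h1 h2) fun x hx => by
    by_cases h : x ∈ s
    · exact Or.inr ⟨h, hx.2⟩
    · exact Or.inl ⟨hx.1, h⟩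

theorem diff_self_mem (s : Set X) : s \ s ∈ D.carrier := by
  rw [Set.sdiff_self]
  exact D.empty_mem

/-- Equality of sets modulo a `σ`-ideal. -/
def setoid : Setoid R.carrier where
  r s t := s.1 \ t.1 ∈ D.carrier ∧ t.1 \ s.1 ∈ D.carrier
  iseqv :=
    { refl := fun s => ⟨D.diff_self_mem s, D.diff_self_mem s⟩
      symm := fun h => ⟨h.2, h.1⟩
      trans := fun {r _ t} h1 h2 =>
        ⟨D.diff_trans r.2 t.2 h1.1 h2.1, D.diff_trans t.2 r.2 h2.2 h1.2⟩ }

/-- The factor algebra of a `σ`-ring of sets by a `σ`-ideal. -/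
def Factor : Type u := Quotient D.setoid

/-- The factorisation homomorphism. -/
def toFactor (s : R.carrier) : D.Factor := Quotient.mk D.setoid s

/-- The natural Boolean operations on the factor algebra, with `[s] ≤ [t]` iff
`s \ t` lies in the ideal. -/
instance : GeneralizedBooleanAlgebra D.Factor where
  le := Quotient.lift₂ (fun s t => s.1 \ t.1 ∈ D.carrier) fun s t s' t' h1 h2 =>
    propext ⟨fun h => D.diff_trans s'.2 t'.2 h1.2 (D.diff_trans s.2 t'.2 h h2.1),
      fun h => D.diff_trans s.2 t.2 h1.1 (D.diff_trans s'.2 t.2 h h2.2)⟩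
  le_refl := Quotient.ind fun s => D.diff_self_mem s
  le_trans a b c := Quotient.inductionOn₃ a b c fun r s t h1 h2 =>
    D.diff_trans r.2 t.2 h1 h2
  le_antisymm a b := Quotient.inductionOn₂ a b fun s t h1 h2 => Quotient.sound ⟨h1, h2⟩
  sup := Quotient.map₂ (fun s t => ⟨s.1 ∪ t.1, R.union_mem s.2 t.2⟩)
    fun s s' h1 t t' h2 =>
      ⟨D.mem_of_subset (R.diff_mem (R.union_mem s.2 t.2) (R.union_mem s'.2 t'.2))
          (D.union_mem h1.1 h2.1) (by intro x; simp only [mem_sdiff, mem_union]; tauto),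
        D.mem_of_subset (R.diff_mem (R.union_mem s'.2 t'.2) (R.union_mem s.2 t.2))
          (D.union_mem h1.2 h2.2) (by intro x; simp only [mem_sdiff, mem_union]; tauto)⟩
  inf := Quotient.map₂ (fun s t => ⟨s.1 ∩ t.1, R.inter_mem s.2 t.2⟩)
    fun s s' h1 t t' h2 =>
      ⟨D.mem_of_subset (R.diff_mem (R.inter_mem s.2 t.2) (R.inter_mem s'.2 t'.2))
          (D.union_mem h1.1 h2.1)
          (by intro x; simp only [mem_sdiff, mem_union, mem_inter_iff]; tauto),
        D.mem_of_subset (R.diff_mem (R.inter_mem s'.2 t'.2) (R.inter_mem s.2 t.2))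
          (D.union_mem h1.2 h2.2)
          (by intro x; simp only [mem_sdiff, mem_union, mem_inter_iff]; tauto)⟩
  sdiff := Quotient.map₂ (fun s t => ⟨s.1 \ t.1, R.diff_mem s.2 t.2⟩)
    fun s s' h1 t t' h2 =>
      ⟨D.mem_of_subset (R.diff_mem (R.diff_mem s.2 t.2) (R.diff_mem s'.2 t'.2))
          (D.union_mem h1.1 h2.2) (by intro x; simp only [mem_sdiff, mem_union]; tauto),
        D.mem_of_subset (R.diff_mem (R.diff_mem s'.2 t'.2) (R.diff_mem s.2 t.2))
          (D.union_mem h1.2 h2.1) (by intro x; simp only [mem_sdiff, mem_union]; tauto)⟩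
  bot := D.toFactor ⟨∅, R.empty_mem⟩
  le_sup_left a b := Quotient.inductionOn₂ a b fun s t => by
    change s.1 \ (s.1 ∪ t.1) ∈ D.carrier
    rw [sdiff_eq_empty.2 subset_union_left]
    exact D.empty_mem
  le_sup_right a b := Quotient.inductionOn₂ a b fun s t => by
    change t.1 \ (s.1 ∪ t.1) ∈ D.carrier
    rw [sdiff_eq_empty.2 subset_union_right]
    exact D.empty_mem
  sup_le a b c := Quotient.inductionOn₃ a b c fun r s t h1 h2 => by
    change (r.1 ∪ s.1) \ t.1 ∈ D.carrier
    rw [Set.union_sdiff_distrib]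
    exact D.union_mem h1 h2
  inf_le_left a b := Quotient.inductionOn₂ a b fun s t => by
    change (s.1 ∩ t.1) \ s.1 ∈ D.carrier
    rw [sdiff_eq_empty.2 inter_subset_left]
    exact D.empty_mem
  inf_le_right a b := Quotient.inductionOn₂ a b fun s t => by
    change (s.1 ∩ t.1) \ t.1 ∈ D.carrier
    rw [sdiff_eq_empty.2 inter_subset_right]
    exact D.empty_mem
  le_inf a b c := Quotient.inductionOn₃ a b c fun r s t h1 h2 => by
    change r.1 \ (s.1 ∩ t.1) ∈ D.carrier
    rw [Set.sdiff_inter]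
    exact D.union_mem h1 h2
  le_sup_inf a b c := Quotient.inductionOn₃ a b c fun r s t => by
    change ((r.1 ∪ s.1) ∩ (r.1 ∪ t.1)) \ (r.1 ∪ (s.1 ∩ t.1)) ∈ D.carrier
    rw [← union_inter_distrib_left]
    exact D.diff_self_mem _
  sup_inf_sdiff a b := Quotient.inductionOn₂ a b fun s t =>
    congrArg D.toFactor (Subtype.ext (Set.inter_union_sdiff s.1 t.1))
  inf_inf_sdiff a b := Quotient.inductionOn₂ a b fun s t =>
    congrArg D.toFactor (Subtype.ext (_root_.inf_inf_sdiff s.1 t.1))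

end SigmaIdeal

/-! ### The completion of the ring of open compact sets -/

section Completion

variable (X : Type u) [TopologicalSpace X]

/-- The family `A₀` of all open compact subsets of `X`. -/
def openCompacts : Set (Set X) := {s | IsOpen s ∧ IsCompact s}

/-- The compact subsets of `X` of the first category. -/
def compactMeagre : Set (Set X) := {s | IsCompact s ∧ IsMeagre s}

/-- The `σ`-completion `A_σ = A₀ ∨ Δ_σ`: the `σ`-ring generated by the open compact sets and the
compact sets of the first category. -/
def sigmaCompletion : SigmaRing X := SigmaRing.generate (openCompacts X ∪ compactMeagre X)

/-- The `σ`-ideal `Δ_σ` of `A_σ` generated by the compact sets of the first category: the members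
of `A_σ` that are covered by countably many compact sets of the first category. -/
def firstCategoryIdeal : SigmaIdeal (sigmaCompletion X) where
  carrier := {s | s ∈ (sigmaCompletion X).carrier ∧
    ∃ K : ℕ → Set X, (∀ n, K n ∈ compactMeagre X) ∧ s ⊆ ⋃ n, K n}
  subset _ hs := hs.1
  empty_mem := ⟨SigmaRing.empty_mem _, fun _ => ∅, fun _ => ⟨isCompact_empty, IsMeagre.empty⟩,
    empty_subset _⟩
  inter_mem := fun hs ⟨ht, K, hK, h⟩ =>
    ⟨SigmaRing.inter_mem _ hs ht, K, hK, inter_subset_right.trans h⟩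
  iUnion_mem {f} hf := by
    refine ⟨SigmaRing.iUnion_mem _ fun n => (hf n).1, ?_⟩
    choose K hK h using fun n => (hf n).2
    refine ⟨fun m => K m.unpair.1 m.unpair.2, fun m => hK _ _, iUnion_subset fun n => ?_⟩
    refine (h n).trans (iUnion_subset fun k => ?_)
    exact subset_iUnion_of_subset (Nat.pair n k) (by simp)

end Completion

/-! ### The space of maximal filters -/

section MaximalFilters

variable (B : Type u) [SigmaSemiring B]

/-- (Proper) filters of a semiring. -/
structure IsSemiringFilter {B : Type u} [SigmaSemiring B] (x : Set B) : Prop where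
  nonempty : x.Nonempty
  bot_notMem : ⊥ ∉ x
  mem_of_le : ∀ {a b : B}, a ∈ x → a ≤ b → b ∈ x
  inf_mem : ∀ {a b : B}, a ∈ x → b ∈ x → a ⊓ b ∈ x

/-- The set `X₀` of maximal filters. -/
def MaximalFilter : Type u := {x : Set B // Maximal IsSemiringFilter x}

/-- `h₀ b` is the set of the maximal filters containing `b`. -/
def stoneMap {B : Type u} [SigmaSemiring B] (b : B) : Set (MaximalFilter B) := {x | b ∈ x.1}

/-- The topology on `X₀` with base `{h₀ b}`. -/
instance : TopologicalSpace (MaximalFilter B) :=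
  TopologicalSpace.generateFrom (range (stoneMap (B := B)))

end MaximalFilters

/-! Everything rests on finite splitting: any `a` is a finite sum of pieces, each below a given `b`
or disjoint from it. Hence if `a ≤ b` fails, some nonzero part of `a` is disjoint from `b`, and a
filter is maximal as soon as it contains a summand of every finite sum it contains. It follows that
the sets `h₀ b` are compact open, form a base of the Hausdorff space `X₀`, and reproduce the order,
the products and the finite sums of the semiring. Infinite sums and meets need not become unions and
intersections, but the error is small. The sets `h₀ (∑ A) \ ⋃ h₀ a` and `⋂ h₀ (bₙ) \ h₀ (⋀ bₙ)` are
compact and contain no nonempty basic set, so they are nowhere dense and lie in `Δ_σ`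
(`isLUB_stoneFactor`, `isGLB_stoneFactor`). Conversely, `X₀` is a Baire space, so the open set `h₀ a
\ h₀ b` is meagre only if it is empty. Passing to classes therefore loses nothing
(`stoneFactor_le_iff`), and the structure is transported to the image. -/

namespace SigmaSemiring

/-! ### Finite splitting of elements. -/

variable {B : Type u} [SigmaSemiring B]

/-- An element disjoint from all the members of a summable set is disjoint from its sum. -/
theorem inf_eq_bot_of_isLUB {A : Set B} {s c : B} (hA : IsSummable A) (hs : IsLUB A s)
    (h : ∀ a ∈ A, c ⊓ a = ⊥) : c ⊓ s = ⊥ := by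
  refine le_bot_iff.1 ((isLUB_inf c hA hs).2 ?_)
  rintro _ ⟨a, ha, rfl⟩
  exact (h a ha).le

/-- For all `a`, `b`, the element `a` is the sum of a finite summable set, each of whose members
lies below `b` or is disjoint from `b`. -/
theorem exists_finite_decomposition (a b : B) :
    ∃ A : Set B, A.Finite ∧ IsSummable A ∧ IsLUB A a ∧ ∀ c ∈ A, c ≤ b ∨ c ⊓ b = ⊥ := by
  obtain ⟨A₁, A₂, C, hC, hCs, h1, h2, hA, hB, -⟩ := exists_decomposition a b
  refine ⟨A₁, hC.subset h1, hA.1, hA.2, fun c hc => ?_⟩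
  by_cases hc2 : c ∈ A₂
  · exact Or.inl (hB.2.1 hc2)
  -- A member of `C` outside `A₂` is disjoint from every member of `A₂`, hence from their sum `b`.
  · refine Or.inr (inf_eq_bot_of_isLUB hB.1 hB.2 fun y hy => ?_)
    exact disjoint hCs c (h1 hc) y (h2 hy) fun h => hc2 (h ▸ hy)

/-- Split `a` along `b`: if every piece were below `b`, so would be their least upper bound `a`. A
piece not below `b` is the required element. -/
theorem exists_le_inf_eq_bot_of_not_le {a b : B} (h : ¬ a ≤ b) :
    ∃ c, c ≠ ⊥ ∧ c ≤ a ∧ c ⊓ b = ⊥ := by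
  obtain ⟨A, -, hA, ha, hAb⟩ := exists_finite_decomposition a b
  by_contra! hc
  refine h (ha.2 fun c hcA => (hAb c hcA).resolve_right ?_)
  exact hc c (fun h => bot_notMem hA (h ▸ hcA)) (ha.1 hcA)

end SigmaSemiring

/-! ### The Stone space of maximal filters. -/

section MaximalFilters

open SigmaSemiring

variable {B : Type u} [SigmaSemiring B]

/-- Otherwise the filter generated by `x` and `a` would be proper, contradicting maximality. -/
theorem IsSemiringFilter.exists_inf_eq_bot_of_maximal {x : Set B}
    (hx : Maximal IsSemiringFilter x) {a : B} (ha : a ∉ x) : ∃ c ∈ x, c ⊓ a = ⊥ := by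
  by_contra! h
  refine ha (hx.2 (y := {d | ∃ c ∈ x, c ⊓ a ≤ d}) ⟨?_, ?_, ?_, ?_⟩
    (fun c hc => ⟨c, hc, inf_le_left⟩) ?_)
  · obtain ⟨c, hc⟩ := hx.1.nonempty
    exact ⟨c, c, hc, inf_le_left⟩
  · rintro ⟨c, hc, hca⟩
    exact h c hc (le_bot_iff.1 hca)
  · rintro d e ⟨c, hc, hcd⟩ hde
    exact ⟨c, hc, hcd.trans hde⟩
  · rintro d e ⟨c, hc, hcd⟩ ⟨c', hc', hce⟩
    exact ⟨c ⊓ c', hx.1.inf_mem hc hc', le_inf ((inf_le_inf_right a inf_le_left).trans hcd)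
      ((inf_le_inf_right a inf_le_right).trans hce)⟩
  · obtain ⟨c, hc⟩ := hx.1.nonempty
    exact ⟨c, hc, inf_le_right⟩

/-- A filter that contains a summand of each finite sum it contains is maximal. -/
theorem IsSemiringFilter.maximal_of_finite_sum {x : Set B} (hx : IsSemiringFilter x)
    (h : ∀ (A : Set B) (s : B), A.Finite → IsSummable A → IsLUB A s → s ∈ x → ∃ a ∈ A, a ∈ x) :
    Maximal IsSemiringFilter x := by
  refine ⟨hx, fun y hy hxy a ha => ?_⟩
  obtain ⟨b, hb⟩ := hx.nonempty
  -- Split an element `b` of `x` along `a`. The piece lying in `x` cannot be disjoint from `a`,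
  -- since both belong to the proper filter `y`.
  obtain ⟨A, hAf, hA, hAb, hAa⟩ := exists_finite_decomposition b a
  obtain ⟨c, hcA, hc⟩ := h A b hAf hA hAb hb
  refine hx.mem_of_le hc ((hAa c hcA).resolve_right fun h0 => ?_)
  exact hy.bot_notMem (h0 ▸ hy.inf_mem (hxy hc) ha)

theorem IsSemiringFilter.exists_maximal_mem {a : B} (ha : a ≠ ⊥) :
    ∃ x : Set B, Maximal IsSemiringFilter x ∧ a ∈ x := by
  have h0 : IsSemiringFilter (Ici a) :=
    ⟨⟨a, le_rfl⟩, fun h => ha (le_bot_iff.1 h), fun h h' => le_trans h h',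
      fun h h' => le_inf h h'⟩
  obtain ⟨m, hm, hmax⟩ := zorn_subset_nonempty {x : Set B | IsSemiringFilter x}
    (fun c hc hchain hne => by
      refine ⟨⋃₀ c, ⟨?_, ?_, ?_, ?_⟩, fun s hs => subset_sUnion_of_mem hs⟩
      · obtain ⟨s, hs⟩ := hne
        obtain ⟨b, hb⟩ := (hc hs).nonempty
        exact ⟨b, s, hs, hb⟩
      · rintro ⟨s, hs, h⟩
        exact (hc hs).bot_notMem h
      · rintro b d ⟨s, hs, h⟩ hbd
        exact ⟨s, hs, (hc hs).mem_of_le h hbd⟩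
      · rintro b d ⟨s, hs, h⟩ ⟨t, ht, h'⟩
        rcases hchain.total hs ht with hst | hst
        · exact ⟨t, ht, (hc ht).inf_mem (hst h) h'⟩
        · exact ⟨s, hs, (hc hs).inf_mem h (hst h')⟩)
    (Ici a) h0
  exact ⟨m, hmax, hm le_rfl⟩

theorem stoneMap_bot : stoneMap (⊥ : B) = ∅ :=
  eq_empty_of_forall_notMem fun x hx => x.2.1.bot_notMem hx

theorem stoneMap_inf (a b : B) : stoneMap (a ⊓ b) = stoneMap a ∩ stoneMap b := by
  ext x
  exact ⟨fun h => ⟨x.2.1.mem_of_le h inf_le_left, x.2.1.mem_of_le h inf_le_right⟩,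
    fun h => x.2.1.inf_mem h.1 h.2⟩

theorem stoneMap_mono : Monotone (stoneMap (B := B)) :=
  fun _ _ h x hx => x.2.1.mem_of_le hx h

theorem stoneMap_nonempty {a : B} (ha : a ≠ ⊥) : (stoneMap a).Nonempty := by
  obtain ⟨x, hx, hax⟩ := IsSemiringFilter.exists_maximal_mem ha
  exact ⟨⟨x, hx⟩, hax⟩

theorem disjoint_stoneMap_iff {a b : B} : Disjoint (stoneMap a) (stoneMap b) ↔ a ⊓ b = ⊥ := by
  rw [disjoint_iff_inter_eq_empty, ← stoneMap_inf]
  refine ⟨fun h => ?_, fun h => by rw [h, stoneMap_bot]⟩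
  by_contra h0
  exact (stoneMap_nonempty h0).ne_empty h

/-- A nonzero part of `a` disjoint from `b` lies in a maximal filter, which then contains `a` but
not `b`. -/
theorem stoneMap_subset_iff {a b : B} : stoneMap a ⊆ stoneMap b ↔ a ≤ b := by
  refine ⟨fun h => ?_, fun h => stoneMap_mono h⟩
  by_contra hab
  obtain ⟨c, hc, hca, hcb⟩ := exists_le_inf_eq_bot_of_not_le hab
  obtain ⟨x, hx⟩ := stoneMap_nonempty hc
  exact (disjoint_stoneMap_iff.2 hcb).le_bot ⟨hx, h (stoneMap_mono hca hx)⟩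

/-- The Stone map takes finite sums to unions. -/
theorem stoneMap_eq_biUnion {A : Set B} {s : B} (hf : A.Finite) (hA : IsSummable A)
    (hs : IsLUB A s) : stoneMap s = ⋃ a ∈ A, stoneMap a := by
  refine Subset.antisymm (fun x hx => ?_) (iUnion₂_subset fun a ha => stoneMap_mono (hs.1 ha))
  by_contra hx'
  have h1 : ∀ a ∈ A, ∃ c ∈ x.1, c ⊓ a = ⊥ := fun a ha =>
    IsSemiringFilter.exists_inf_eq_bot_of_maximal x.2
      fun h => hx' (mem_iUnion₂.2 ⟨a, ha, h⟩)
  have h2 : ∃ c ∈ x.1, ∀ a ∈ A, c ⊓ a = ⊥ := by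
    -- Subsets of a summable set need not be summable, so these hypotheses on `A` would not survive
    -- the induction.
    clear hA hs hx'
    induction A, hf using Set.Finite.induction_on with
    | empty => exact ⟨s, hx, by simp⟩
    | @insert a A _ _ ih =>
      obtain ⟨c, hc, hcA⟩ := ih fun b hb => h1 b (mem_insert_of_mem a hb)
      obtain ⟨d, hd, hda⟩ := h1 a (mem_insert a A)
      refine ⟨c ⊓ d, x.2.1.inf_mem hc hd, ?_⟩
      rintro b (rfl | hb)
      · exact le_bot_iff.1 (hda ▸ inf_le_inf_right b inf_le_right)
      · exact le_bot_iff.1 (hcA b hb ▸ inf_le_inf_right b inf_le_left)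
  obtain ⟨c, hc, hcA⟩ := h2
  exact x.2.1.bot_notMem (inf_eq_bot_of_isLUB hA hs hcA ▸ x.2.1.inf_mem hc hx)

theorem isOpen_stoneMap (b : B) : IsOpen (stoneMap b) :=
  TopologicalSpace.isOpen_generateFrom_of_mem ⟨b, rfl⟩

theorem isTopologicalBasis_stoneMap :
    TopologicalSpace.IsTopologicalBasis (range (stoneMap (B := B))) where
  exists_subset_inter := by
    rintro _ ⟨a, rfl⟩ _ ⟨b, rfl⟩ x hx
    exact ⟨_, ⟨a ⊓ b, rfl⟩, by rwa [stoneMap_inf], by rw [stoneMap_inf]⟩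
  sUnion_eq := by
    refine eq_univ_of_forall fun x => ?_
    obtain ⟨b, hb⟩ := x.2.1.nonempty
    exact ⟨_, ⟨b, rfl⟩, hb⟩
  eq_generateFrom := rfl

theorem isClosed_stoneMap (b : B) : IsClosed (stoneMap b) := by
  rw [← isOpen_compl_iff, isTopologicalBasis_stoneMap.isOpen_iff]
  intro x hx
  obtain ⟨c, hc, hcb⟩ := IsSemiringFilter.exists_inf_eq_bot_of_maximal x.2 hx
  exact ⟨_, ⟨c, rfl⟩, hc, (disjoint_stoneMap_iff.2 hcb).subset_compl_right⟩

/-- For an ultrafilter `F` containing `h₀ b`, the elements `a` with `h₀ a ∈ F` form a filter. It is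
maximal because an ultrafilter containing a finite union contains one of its terms; this maximal
filter is a limit of `F`. -/
theorem isCompact_stoneMap (b : B) : IsCompact (stoneMap b) := by
  rw [isCompact_iff_ultrafilter_le_nhds']
  intro F hF
  have h1 : IsSemiringFilter {a : B | stoneMap a ∈ F} := by
    refine ⟨⟨b, hF⟩, ?_, fun ha hab => F.mem_of_superset ha (stoneMap_mono hab), ?_⟩
    · rw [mem_ofPred_eq, stoneMap_bot]
      exact F.empty_notMem
    · intro a c ha hc
      rw [mem_ofPred_eq, stoneMap_inf]
      exact Filter.inter_mem ha hc
  have h2 : Maximal IsSemiringFilter {a : B | stoneMap a ∈ F} := by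
    refine h1.maximal_of_finite_sum fun A s hf hA hs h => ?_
    rw [mem_ofPred_eq, stoneMap_eq_biUnion hf hA hs] at h
    exact (Ultrafilter.finite_biUnion_mem_iff hf).1 h
  let x : MaximalFilter B := ⟨_, h2⟩
  refine ⟨x, hF, ?_⟩
  rw [isTopologicalBasis_stoneMap.nhds_hasBasis.ge_iff]
  rintro _ ⟨⟨a, rfl⟩, ha⟩
  exact ha

instance : T2Space (MaximalFilter B) := by
  refine ⟨fun x y hxy => ?_⟩
  -- By maximality, inclusion in one direction already forces equality.
  have h : ¬ x.1 ⊆ y.1 := fun h =>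
    hxy (Subtype.ext (h.antisymm (x.2.2 y.2.1 h)))
  obtain ⟨a, hax, hay⟩ := not_subset.1 h
  obtain ⟨c, hc, hca⟩ := IsSemiringFilter.exists_inf_eq_bot_of_maximal y.2 hay
  exact ⟨stoneMap a, stoneMap c, isOpen_stoneMap a, isOpen_stoneMap c, hax, hc,
    (disjoint_stoneMap_iff.2 hca).symm⟩

instance : LocallyCompactSpace (MaximalFilter B) := by
  refine .of_hasBasis (fun x => isTopologicalBasis_stoneMap.nhds_hasBasis) ?_
  rintro x _ ⟨⟨a, rfl⟩, -⟩
  exact isCompact_stoneMap a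

theorem stoneMap_mem_sigmaCompletion (b : B) :
    stoneMap b ∈ (sigmaCompletion (MaximalFilter B)).carrier :=
  SigmaRing.subset_generate _ (Or.inl ⟨isOpen_stoneMap b, isCompact_stoneMap b⟩)

end MaximalFilters

/-! ### Category in Baire spaces and the ideal `Δ_σ`. -/

section FirstCategory

theorem IsOpen.eq_empty_of_isMeagre {X : Type*} [TopologicalSpace X] [BaireSpace X] {s : Set X}
    (ho : IsOpen s) (hs : IsMeagre s) : s = ∅ := by
  have h : Dense sᶜ := dense_of_mem_residual hs
  rw [← compl_univ_iff, ← ho.isClosed_compl.closure_eq, h.closure_eq]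

variable {X : Type u} [TopologicalSpace X]

theorem isMeagre_of_mem_firstCategoryIdeal {s : Set X}
    (hs : s ∈ (firstCategoryIdeal X).carrier) : IsMeagre s := by
  obtain ⟨-, K, hK, h⟩ := hs
  exact (isMeagre_iUnion fun n => (hK n).2).mono h

/-- Compact sets with empty interior belong to the ideal `Δ_σ`. -/
theorem mem_firstCategoryIdeal_of_interior_eq_empty [T2Space X] {s : Set X} (hs : IsCompact s)
    (h : interior s = ∅) : s ∈ (firstCategoryIdeal X).carrier := by
  have h1 : s ∈ compactMeagre X :=
    ⟨hs, IsNowhereDense.isMeagre (hs.isClosed.isNowhereDense_iff.2 h)⟩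
  exact ⟨SigmaRing.subset_generate _ (Or.inr h1), fun _ => s, fun _ => h1,
    subset_iUnion (fun _ : ℕ => s) 0⟩

end FirstCategory

/-! ### Countable bounds in a factor algebra. -/

namespace SigmaIdeal

variable {X : Type u} {R : SigmaRing X} (D : SigmaIdeal R)

theorem toFactor_le_toFactor {s t : R.carrier} :
    D.toFactor s ≤ D.toFactor t ↔ s.1 \ t.1 ∈ D.carrier :=
  Iff.rfl

/-- If `s` is the union of the `f i`, `i` in a countable set `I`, up to a member of the ideal,
then its class is the least upper bound of the classes of the `f i`. -/
theorem isLUB_toFactor_image {ι : Type*} {I : Set ι} (hI : I.Countable) {f : ι → R.carrier}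
    {s : R.carrier} (h1 : ∀ i ∈ I, (f i).1 ⊆ s.1)
    (h2 : s.1 \ ⋃ i ∈ I, (f i).1 ∈ D.carrier) :
    IsLUB ((fun i => D.toFactor (f i)) '' I) (D.toFactor s) := by
  constructor
  · rintro _ ⟨i, hi, rfl⟩
    rw [toFactor_le_toFactor, sdiff_eq_empty.2 (h1 i hi)]
    exact D.empty_mem
  · intro q
    refine Quotient.inductionOn q fun t ht => ?_
    have h3 : ∀ i ∈ I, (f i).1 \ t.1 ∈ D.carrier := fun i hi => ht ⟨i, hi, rfl⟩
    -- An empty `I` has no enumeration by `ℕ`; in that case `s` itself lies in the ideal.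
    rcases I.eq_empty_or_nonempty with rfl | hne
    · refine D.mem_of_subset (R.diff_mem s.2 t.2) h2 fun x hx => ?_
      simpa using hx.1
    · obtain ⟨g, rfl⟩ := hI.exists_eq_range hne
      refine D.mem_of_subset (R.diff_mem s.2 t.2) (D.union_mem h2
        (D.iUnion_mem fun n : ℕ => h3 (g n) ⟨n, rfl⟩)) fun x hx => ?_
      simp only [mem_union, mem_sdiff, mem_iUnion, mem_range, exists_prop,
        exists_exists_eq_and]
      by_cases h : ∃ n, x ∈ (f (g n)).1
      · exact Or.inr (h.imp fun n hn => ⟨hn, hx.2⟩)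
      · exact Or.inl ⟨hx.1, h⟩

/-- If `s` is the intersection of the `f n` up to a member of the ideal, then its class is the
greatest lower bound of the classes of the `f n`. -/
theorem isGLB_range_toFactor {f : ℕ → R.carrier} {s : R.carrier} (h1 : ∀ n, s.1 ⊆ (f n).1)
    (h2 : (⋂ n, (f n).1) \ s.1 ∈ D.carrier) :
    IsGLB (range fun n => D.toFactor (f n)) (D.toFactor s) := by
  constructor
  · rintro _ ⟨n, rfl⟩
    rw [toFactor_le_toFactor, sdiff_eq_empty.2 (h1 n)]
    exact D.empty_mem
  · intro q
    refine Quotient.inductionOn q fun t ht => ?_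
    have h3 : ∀ n, t.1 \ (f n).1 ∈ D.carrier := fun n => ht ⟨n, rfl⟩
    refine D.mem_of_subset (R.diff_mem t.2 s.2) (D.union_mem h2 (D.iUnion_mem h3))
      fun x hx => ?_
    simp only [mem_union, mem_sdiff, mem_iUnion, mem_iInter]
    by_cases h : ∀ n, x ∈ (f n).1
    · exact Or.inl ⟨h, hx.2⟩
    · exact Or.inr ((not_forall.1 h).imp fun n hn => ⟨hx.1, hn⟩)

end SigmaIdeal

/-! ### The embedding into the factor algebra. -/

section StoneFactor

open SigmaSemiring

variable {B : Type u} [SigmaSemiring B]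

/-- The map `b ↦ [h₀ b]`. -/
def stoneFactor (b : B) : (firstCategoryIdeal (MaximalFilter B)).Factor :=
  (firstCategoryIdeal (MaximalFilter B)).toFactor ⟨stoneMap b, stoneMap_mem_sigmaCompletion b⟩

/-- The difference `h₀ a \ h₀ b` is open, and in the locally compact Hausdorff space `X₀` an open
meagre set is empty. -/
theorem stoneFactor_le_iff {a b : B} : stoneFactor a ≤ stoneFactor b ↔ a ≤ b := by
  rw [stoneFactor, stoneFactor, SigmaIdeal.toFactor_le_toFactor, ← stoneMap_subset_iff]
  constructor
  · intro h
    exact sdiff_eq_empty.1 (((isOpen_stoneMap a).sdiff (isClosed_stoneMap b)).eq_empty_of_isMeagre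
      (isMeagre_of_mem_firstCategoryIdeal h))
  · intro h
    rw [sdiff_eq_empty.2 h]
    exact SigmaIdeal.empty_mem _

/-- The map `b ↦ [h₀ b]` as an order embedding. -/
def stoneFactorEmbedding : B ↪o (firstCategoryIdeal (MaximalFilter B)).Factor :=
  OrderEmbedding.ofMapLEIff stoneFactor fun _ _ => stoneFactor_le_iff

theorem stoneFactor_injective : Function.Injective (stoneFactor (B := B)) :=
  stoneFactorEmbedding.injective

theorem stoneFactor_bot : stoneFactor (⊥ : B) = ⊥ :=
  congrArg (SigmaIdeal.toFactor _) (Subtype.ext stoneMap_bot)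

theorem stoneFactor_eq_bot {a : B} : stoneFactor a = ⊥ ↔ a = ⊥ := by
  rw [← stoneFactor_bot, stoneFactor_injective.eq_iff]

theorem stoneFactor_inf (a b : B) : stoneFactor (a ⊓ b) = stoneFactor a ⊓ stoneFactor b :=
  congrArg (SigmaIdeal.toFactor _) (Subtype.ext (stoneMap_inf a b))

/-- Needed for associativity in the image, where the decompositions are given by least upper bounds
in the factor algebra. -/
theorem isLUB_of_isLUB_stoneFactor {A : Set B} {s : B}
    (h : IsLUB (stoneFactor '' A) (stoneFactor s)) : IsLUB A s :=
  ⟨fun _ ha => stoneFactor_le_iff.1 (h.1 ⟨_, ha, rfl⟩), fun v hv =>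
    stoneFactor_le_iff.1 (h.2 (by rintro _ ⟨a, ha, rfl⟩; exact stoneFactor_le_iff.2 (hv ha)))⟩

/-- A subset of `X₀` that contains no `h₀ c`, `c ≠ ⊥`, has empty interior. -/
theorem interior_eq_empty_of_stoneMap {S : Set (MaximalFilter B)}
    (h : ∀ c : B, stoneMap c ⊆ S → c = ⊥) : interior S = ∅ := by
  by_contra hne
  obtain ⟨x, hx⟩ := nonempty_iff_ne_empty.2 hne
  obtain ⟨_, ⟨c, rfl⟩, hxc, hc⟩ := isTopologicalBasis_stoneMap.isOpen_iff.1 isOpen_interior x hx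
  rw [h c (hc.trans interior_subset), stoneMap_bot] at hxc
  exact hxc

/-- If `h₀ c` lies in `h₀ s \ ⋃ h₀ a`, then `c ≤ s` is disjoint from every summand, so
distributivity gives `c = c ⊓ s = ⊥`. -/
theorem isLUB_stoneFactor {A : Set B} {s : B} (hA : IsSummable A) (hs : IsLUB A s) :
    IsLUB (stoneFactor '' A) (stoneFactor s) := by
  refine SigmaIdeal.isLUB_toFactor_image _ (countable hA) (fun a ha => stoneMap_mono (hs.1 ha)) ?_
  refine mem_firstCategoryIdeal_of_interior_eq_empty
    ((isCompact_stoneMap s).diff (isOpen_biUnion fun a _ => isOpen_stoneMap a))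
    (interior_eq_empty_of_stoneMap fun c hc => ?_)
  have h1 : c ≤ s := stoneMap_subset_iff.1 (hc.trans sdiff_subset)
  rw [← inf_eq_left.2 h1]
  refine inf_eq_bot_of_isLUB hA hs fun a ha => disjoint_stoneMap_iff.1 ?_
  exact disjoint_left.2 fun x hx hxa => (hc hx).2 (mem_iUnion₂.2 ⟨a, ha, hxa⟩)

/-- If `h₀ c` lies in `⋂ h₀ (f n) \ h₀ b`, then `c` is a lower bound of the `f n`, so `c ≤ b`; but
`c` is also disjoint from `b`, so `c = ⊥`. -/
theorem isGLB_stoneFactor {f : ℕ → B} {b : B} (hb : IsGLB (range f) b) :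
    IsGLB (range fun n => stoneFactor (f n)) (stoneFactor b) := by
  refine SigmaIdeal.isGLB_range_toFactor _ (fun n => stoneMap_mono (hb.1 ⟨n, rfl⟩)) ?_
  refine mem_firstCategoryIdeal_of_interior_eq_empty
    -- The intersection is closed inside the compact set `h₀ (f 0)`.
    (((isCompact_stoneMap (f 0)).of_isClosed_subset
      (isClosed_iInter fun n => isClosed_stoneMap (f n)) (iInter_subset _ 0)).diff
        (isOpen_stoneMap b))
    (interior_eq_empty_of_stoneMap fun c hc => ?_)
  have h1 : c ≤ b := hb.2 (by
    rintro _ ⟨n, rfl⟩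
    exact stoneMap_subset_iff.1 (hc.trans (sdiff_subset.trans (iInter_subset _ n))))
  rw [← inf_eq_left.2 h1]
  exact disjoint_stoneMap_iff.1 (disjoint_left.2 fun x hx => (hc hx).2)

/-- The image of `B` under `b ↦ [h₀ b]`, with the images of the summable sets. -/
def stoneSubsemiring (B : Type u) [SigmaSemiring B] :
    SigmaSubsemiring (firstCategoryIdeal (MaximalFilter B)).Factor where
  carrier := range stoneFactor
  IsSummable S := ∃ A : Set B, IsSummable A ∧ stoneFactor '' A = S
  bot_mem := ⟨⊥, stoneFactor_bot⟩
  inf_mem := by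
    rintro _ _ ⟨a, rfl⟩ ⟨b, rfl⟩
    exact ⟨a ⊓ b, stoneFactor_inf a b⟩
  subset_carrier := by
    rintro _ ⟨A, -, rfl⟩
    exact image_subset_range _ _
  bot_notMem := by
    rintro _ ⟨A, hA, rfl⟩ ⟨a, ha, h⟩
    exact SigmaSemiring.bot_notMem hA (stoneFactor_eq_bot.1 h ▸ ha)
  disjoint := by
    rintro _ ⟨A, hA, rfl⟩ _ ⟨a, ha, rfl⟩ _ ⟨b, hb, rfl⟩ hab
    rw [← stoneFactor_inf, stoneFactor_eq_bot]
    exact SigmaSemiring.disjoint hA a ha b hb fun h => hab (congrArg _ h)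
  countable := by
    rintro _ ⟨A, hA, rfl⟩
    exact (SigmaSemiring.countable hA).image _
  exists_isLUB := by
    rintro _ ⟨A, hA, rfl⟩
    obtain ⟨s, hs⟩ := SigmaSemiring.exists_isLUB hA
    exact ⟨_, ⟨s, rfl⟩, isLUB_stoneFactor hA hs⟩
  isSummable_empty := ⟨∅, SigmaSemiring.isSummable_empty, image_empty _⟩
  isSummable_singleton := by
    rintro _ ⟨a, rfl⟩ ha
    exact ⟨{a}, SigmaSemiring.isSummable_singleton fun h => ha (stoneFactor_eq_bot.2 h),
      image_singleton⟩
  isSummable_biUnion := by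
    rintro _ D ⟨A, hA, rfl⟩ hD
    -- Pull the decompositions of the classes back to summable subsets of `B`.
    choose! E hE hED using fun a (ha : a ∈ A) => (hD _ ⟨a, ha, rfl⟩).1
    refine ⟨⋃ a ∈ A, E a, SigmaSemiring.isSummable_biUnion E hA fun a ha => ⟨hE a ha, ?_⟩, ?_⟩
    · refine isLUB_of_isLUB_stoneFactor ?_
      rw [hED a ha]
      exact (hD _ ⟨a, ha, rfl⟩).2
    · rw [image_iUnion₂, biUnion_image]
      exact iUnion₂_congr hED
  isSummable_inf := by
    rintro _ _ ⟨a, rfl⟩ ⟨A, hA, rfl⟩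
    refine ⟨_, SigmaSemiring.isSummable_inf a hA, ?_⟩
    rw [image_sdiff stoneFactor_injective, image_image, image_image, image_singleton,
      stoneFactor_bot]
    simp only [stoneFactor_inf]
  exists_decomposition := by
    rintro _ _ ⟨a, rfl⟩ ⟨b, rfl⟩
    obtain ⟨A₁, A₂, C, hC, hCs, h1, h2, hA, hB, hAB⟩ := SigmaSemiring.exists_decomposition a b
    refine ⟨stoneFactor '' A₁, stoneFactor '' A₂, stoneFactor '' C, hC.image _, ⟨C, hCs, rfl⟩,
      image_mono h1, image_mono h2, ⟨⟨A₁, hA.1, rfl⟩, isLUB_stoneFactor hA.1 hA.2⟩,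
      ⟨⟨A₂, hB.1, rfl⟩, isLUB_stoneFactor hB.1 hB.2⟩, ?_⟩
    rw [← image_inter stoneFactor_injective, ← stoneFactor_inf]
    exact ⟨⟨_, hAB.1, rfl⟩, isLUB_stoneFactor hAB.1 hAB.2⟩
  exists_isGLB := by
    intro f hf
    choose g hg using hf
    obtain ⟨b, hb⟩ := SigmaSemiring.exists_isGLB g
    obtain rfl : (fun n => stoneFactor (g n)) = f := funext hg
    exact ⟨_, ⟨b, rfl⟩, isGLB_stoneFactor hb⟩

/-- The `σ`-isomorphism `b ↦ [h₀ b]` of `B` onto its image. -/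
noncomputable def stoneIso (B : Type u) [SigmaSemiring B] :
    SigmaSemiring.Iso B (stoneSubsemiring B) where
  toOrderIso :=
    { toEquiv := Equiv.ofInjective stoneFactor stoneFactor_injective
      map_rel_iff' := stoneFactor_le_iff }
  isSummable_iff A := by
    change (∃ A' : Set B, IsSummable A' ∧ stoneFactor '' A' = Subtype.val '' (_ '' A)) ↔ _
    rw [image_image]
    change (∃ A' : Set B, IsSummable A' ∧ stoneFactor '' A' = stoneFactor '' A) ↔ _
    -- By injectivity, a summable set with the same image as `A` is `A` itself.
    simp only [stoneFactor_injective.image_injective.eq_iff, exists_eq_right]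

end StoneFactor

/-- The space `X₀` of maximal filters of a `σ`-semiring `B` is a locally compact Hausdorff space,
and `B` is `σ`-isomorphic, by `b ↦ [h₀ b]`, with a `σ`-semiring `Bσ ⊆ A_σ / Δ_σ`. -/
theorem mainTheorem3 (B : Type u) [SigmaSemiring B] :
    LocallyCompactSpace (MaximalFilter B) ∧ T2Space (MaximalFilter B) ∧
    ∃ (Bσ : SigmaSubsemiring (firstCategoryIdeal (MaximalFilter B)).Factor)
      (h : SigmaSemiring.Iso B Bσ), ∀ b : B,
        ∃ hb : stoneMap b ∈ (sigmaCompletion (MaximalFilter B)).carrier,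
          (h.toOrderIso b).1 = (firstCategoryIdeal (MaximalFilter B)).toFactor ⟨stoneMap b, hb⟩ :=
  ⟨inferInstance, inferInstance, stoneSubsemiring B, stoneIso B,
    fun b => ⟨stoneMap_mem_sigmaCompletion b, rfl⟩⟩
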